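/- Let $p$ be a prime, let $S$ be a finite $p$-group and let $\mathcal F$ be a saturated fusion system on $S$. For $P\le S$ put $\mathrm{Aut}_{\mathcal F}(P)=\mathrm{Hom}_{\mathcal F}(P,P)$ and $\mathrm{Out}_{\mathcal F}(P)=\mathrm{Aut}_{\mathcal F}(P)/\mathrm{Inn}(P)\le\mathrm{Out}(P)$. Call $P\le S$ $\mathcal F$-essential if - $P$ is $\mathcal F$-centric, i.e. $C_S(Q)\le Q$ for every $\mathcal F$-conjugate $Q$ of $P$; - $P$ is fully normalized in $\mathcal F$, i.e. $|N_S(P)|\ge|N_S(Q)|$ for every $\mathcal F$-conjugate $Q$ of $P$; - $\mathrm{Out}_{\mathcal F}(P)$ has a strongly $p$-embedded subgroup, i.e. a proper subgroup $H$ with $p\mid |H|$ and $p\nmid|H\cap xHx^{-1}|$ for all $x\in\mathrm{Out}_{\mathcal F}(P)\setminus H$. Let $B(S)$ be the Burnside ring of $S$, i.e. the Grothendieck ring of finite $S$-sets under disjoint union and direct product. For $P\le S$ let $a\mapsto|a^P|$ be the ring homomorphism $B(S)\to\mathbb Z$ with $[X]\mapsto|X^P|$, and let $$B(\mathcal F)=\{a\in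 B(S): |a^P|=|a^Q|\text{ whenever }P,Q\le S\text{ are isomorphic in }\mathcal F\},$$ a subring of $B(S)$. The group $\mathrm{Aut}(S)$ acts on $B(S)$ by ring automorphisms, where $\alpha\cdot[X]$ is the class of the set $X$ on which $g\in S$ acts as $\alpha^{-1}(g)$ did before. Inner automorphisms act trivially, so $\mathrm{Out}(S)$, and hence its subgroup $\mathrm{Out}_{\mathcal F}(S)$, acts on $B(S)$ and on the unit group $B(S)^\times$. **Corollary (no proper essential subgroups).** If no proper subgroup $P<S$ is $\mathcal F$-essential, then, as subgroups of $B(S)^\times$, $$B(\mathcal F)^\times=\left(B(S)^\times\right)^{\mathrm{Out}_{\mathcal F}(S)}.$$ -/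

import Mathlib

universe u v

/-! ## The Grothendieck ring of a commutative semiring -/

section Grothendieck

/-- Two formal differences `a - b` and `c - d` agree in the Grothendieck ring iff
`a + d + k = c + b + k` for some `k`. -/
def grothendieckSetoid (R : Type u) [CommSemiring R] : Setoid (R × R) where
  r x y := ∃ k, x.1 + y.2 + k = y.1 + x.2 + k
  iseqv :=
    { refl := fun _ => ⟨0, rfl⟩
      symm := fun ⟨k, hk⟩ => ⟨k, hk.symm⟩
      trans := by
        rintro ⟨a, b⟩ ⟨c, d⟩ ⟨e, f⟩ ⟨k, hk⟩ ⟨l, hl⟩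
        refine ⟨c + d + k + l, ?_⟩
        simp only at hk hl ⊢
        calc a + f + (c + d + k + l) = (a + d + k) + (c + f + l) := by ring
          _ = (c + b + k) + (e + d + l) := by rw [hk, hl]
          _ = e + b + (c + d + k + l) := by ring }

/-- The Grothendieck ring (ring completion) of a commutative semiring `R`: formal differences
`a - b` of elements of `R`. -/
def GrothendieckRing (R : Type u) [CommSemiring R] : Type u :=
  Quotient (grothendieckSetoid R)

namespace GrothendieckRing

variable {R : Type u} [CommSemiring R]

/-- The formal difference `a - b`. -/
def mk (a b : R) : GrothendieckRing R := Quotient.mk (grothendieckSetoid R) (a, b)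

theorem mk_eq_iff {a b c d : R} : mk a b = mk c d ↔ ∃ k, a + d + k = c + b + k :=
  ⟨fun h => Quotient.exact h, fun h => Quotient.sound h⟩

theorem ind {C : GrothendieckRing R → Prop} (h : ∀ a b, C (mk a b)) (x : GrothendieckRing R) :
    C x :=
  Quotient.inductionOn x fun p => h p.1 p.2

instance : Zero (GrothendieckRing R) := ⟨mk 0 0⟩

instance : One (GrothendieckRing R) := ⟨mk 1 0⟩

instance : Add (GrothendieckRing R) where
  add := Quotient.map₂ (fun x y => (x.1 + y.1, x.2 + y.2)) (by
    rintro ⟨a, b⟩ ⟨a', b'⟩ ⟨k, hk⟩ ⟨c, d⟩ ⟨c', d'⟩ ⟨l, hl⟩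
    refine ⟨k + l, ?_⟩
    simp only at hk hl ⊢
    calc a + c + (b' + d') + (k + l) = (a + b' + k) + (c + d' + l) := by ring
      _ = (a' + b + k) + (c' + d + l) := by rw [hk, hl]
      _ = _ := by ring)

instance : Neg (GrothendieckRing R) where
  neg := Quotient.map (fun x => (x.2, x.1)) (by
    rintro ⟨a, b⟩ ⟨a', b'⟩ ⟨k, hk⟩
    refine ⟨k, ?_⟩
    simp only at hk ⊢
    calc b + a' + k = a' + b + k := by ring
      _ = a + b' + k := hk.symm
      _ = _ := by ring)

instance : Mul (GrothendieckRing R) where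
  mul := Quotient.map₂ (fun x y => (x.1 * y.1 + x.2 * y.2, x.1 * y.2 + x.2 * y.1)) (by
    rintro ⟨a, b⟩ ⟨a', b'⟩ ⟨k, hk⟩ ⟨c, d⟩ ⟨c', d'⟩ ⟨l, hl⟩
    refine ⟨k * c + k * d + a' * l + b' * l + (a' * c + b' * d + a' * d + b' * c), ?_⟩
    simp only at hk hl ⊢
    calc a * c + b * d + (a' * d' + b' * c')
          + (k * c + k * d + a' * l + b' * l + (a' * c + b' * d + a' * d + b' * c))
          = (a + b' + k) * c + (a' + b + k) * d + a' * (c + d' + l) + b' * (c' + d + l) := by ring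
      _ = (a' + b + k) * c + (a + b' + k) * d + a' * (c' + d + l) + b' * (c + d' + l) := by
        rw [hk, hl]
      _ = _ := by ring)

theorem zero_def : (0 : GrothendieckRing R) = mk 0 0 := rfl

theorem one_def : (1 : GrothendieckRing R) = mk 1 0 := rfl

theorem mk_add (a b c d : R) : mk a b + mk c d = mk (a + c) (b + d) := rfl

theorem mk_mul (a b c d : R) : mk a b * mk c d = mk (a * c + b * d) (a * d + b * c) := rfl

theorem neg_mk (a b : R) : -mk a b = mk b a := rfl

instance : CommRing (GrothendieckRing R) where
  add_assoc x y z := by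
    induction x using ind; induction y using ind; induction z using ind
    simp only [mk_add, add_assoc]
  zero_add x := by
    induction x using ind
    simp only [zero_def, mk_add, zero_add]
  add_zero x := by
    induction x using ind
    simp only [zero_def, mk_add, add_zero]
  add_comm x y := by
    induction x using ind; induction y using ind
    simp only [mk_add, add_comm]
  nsmul := nsmulRec
  zsmul := zsmulRec
  neg_add_cancel x := by
    induction x using ind
    rw [neg_mk, mk_add, zero_def, mk_eq_iff]
    exact ⟨0, by ring⟩
  mul_assoc x y z := by
    induction x using ind; induction y using ind; induction z using ind
    simp only [mk_mul]
    congr 1 <;> ring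
  one_mul x := by
    induction x using ind
    simp only [one_def, mk_mul, one_mul, zero_mul, add_zero]
  mul_one x := by
    induction x using ind
    simp only [one_def, mk_mul, mul_one, mul_zero, add_zero, zero_add]
  mul_comm x y := by
    induction x using ind; induction y using ind
    simp only [mk_mul]
    congr 1 <;> ring
  zero_mul x := by
    induction x using ind
    simp only [zero_def, mk_mul, zero_mul, add_zero]
  mul_zero x := by
    induction x using ind
    simp only [zero_def, mk_mul, mul_zero, add_zero]
  left_distrib x y z := by
    induction x using ind; induction y using ind; induction z using ind
    simp only [mk_mul, mk_add]
    congr 1 <;> ring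
  right_distrib x y z := by
    induction x using ind; induction y using ind; induction z using ind
    simp only [mk_mul, mk_add]
    congr 1 <;> ring

/-- The extension of a semiring homomorphism to a ring `A` to the Grothendieck ring:
`a - b ↦ f a - f b`. -/
def lift {A : Type v} [CommRing A] (f : R →+* A) : GrothendieckRing R →+* A where
  toFun := Quotient.lift (fun x : R × R => f x.1 - f x.2) (by
    rintro ⟨a, b⟩ ⟨c, d⟩ ⟨k, hk⟩
    have h := congrArg f hk
    simp only [map_add] at h ⊢
    linear_combination h)
  map_zero' := show f 0 - f 0 = 0 by simp
  map_one' := show f 1 - f 0 = 1 by simp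
  map_add' x y := by
    induction x using ind; induction y using ind
    rename_i a b c d
    change f (a + c) - f (b + d) = (f a - f b) + (f c - f d)
    simp only [map_add]; ring
  map_mul' x y := by
    induction x using ind; induction y using ind
    rename_i a b c d
    change f (a * c + b * d) - f (a * d + b * c) = (f a - f b) * (f c - f d)
    simp only [map_add, map_mul]; ring

/-- A group acting on `R` by semiring automorphisms acts on the Grothendieck ring by ring
automorphisms: `m • (a - b) = m • a - m • b`. -/
instance {M : Type v} [Monoid M] [MulSemiringAction M R] :
    MulSemiringAction M (GrothendieckRing R) where
  smul m := Quotient.map (fun x => (m • x.1, m • x.2)) (by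
    rintro ⟨a, b⟩ ⟨c, d⟩ ⟨k, hk⟩
    refine ⟨m • k, ?_⟩
    simp only at hk ⊢
    rw [← smul_add, ← smul_add, hk, smul_add, smul_add])
  one_smul x := by
    induction x using ind; rename_i a b
    change mk ((1 : M) • a) ((1 : M) • b) = mk a b
    simp only [one_smul]
  mul_smul m n x := by
    induction x using ind; rename_i a b
    change mk ((m * n) • a) ((m * n) • b) = mk (m • n • a) (m • n • b)
    simp only [mul_smul]
  smul_zero m := by
    change mk (m • (0 : R)) (m • (0 : R)) = mk 0 0
    simp only [smul_zero]
  smul_one m := by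
    change mk (m • (1 : R)) (m • (0 : R)) = mk 1 0
    simp only [smul_zero, smul_one]
  smul_add m x y := by
    induction x using ind; induction y using ind; rename_i a b c d
    change mk (m • (a + c)) (m • (b + d)) = mk (m • a + m • c) (m • b + m • d)
    simp only [smul_add]
  smul_mul m x y := by
    induction x using ind; induction y using ind; rename_i a b c d
    change mk (m • (a * c + b * d)) (m • (a * d + b * c))
      = mk ((m • a) * (m • c) + (m • b) * (m • d)) ((m • a) * (m • d) + (m • b) * (m • c))
    simp only [smul_add, smul_mul']

theorem smul_mk {M : Type v} [Monoid M] [MulSemiringAction M R] (m : M) (a b : R) :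
    m • mk a b = mk (m • a) (m • b) := rfl

end GrothendieckRing

end Grothendieck

/-! ## Finite `G`-sets and the Burnside ring -/

section Burnside

/-- A finite (left) `G`-set. -/
structure FinGSet (G : Type u) [Group G] where
  /-- The underlying set. -/
  carrier : Type u
  [finite : Finite carrier]
  [action : MulAction G carrier]

namespace FinGSet

variable {G : Type u} [Group G]

attribute [instance] FinGSet.finite FinGSet.action

/-- An isomorphism of `G`-sets: an equivariant bijection. -/
structure Iso (X Y : FinGSet G) where
  /-- The underlying bijection. -/
  toEquiv : X.carrier ≃ Y.carrier
  map_smul : ∀ (g : G) (x : X.carrier), toEquiv (g • x) = g • toEquiv x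

/-- Isomorphism of finite `G`-sets, as an equivalence relation. -/
instance isoSetoid (G : Type u) [Group G] : Setoid (FinGSet G) where
  r X Y := Nonempty (Iso X Y)
  iseqv :=
    { refl := fun _ => ⟨⟨Equiv.refl _, fun _ _ => rfl⟩⟩
      symm := fun ⟨e⟩ => ⟨⟨e.toEquiv.symm, fun g y => by
        rw [Equiv.symm_apply_eq, e.map_smul, Equiv.apply_symm_apply]⟩⟩
      trans := fun ⟨e⟩ ⟨f⟩ => ⟨⟨e.toEquiv.trans f.toEquiv, fun g x => by
        simp only [Equiv.trans_apply, e.map_smul, f.map_smul]⟩⟩ }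

/-- The empty `G`-set. -/
def empty (G : Type u) [Group G] : FinGSet G where
  carrier := PEmpty
  action := { smul := fun _ x => x, one_smul := fun _ => rfl, mul_smul := fun _ _ _ => rfl }

/-- The one-point `G`-set `G/G`. -/
def point (G : Type u) [Group G] : FinGSet G where
  carrier := PUnit
  action := { smul := fun _ x => x, one_smul := fun _ => rfl, mul_smul := fun _ _ _ => rfl }

/-- The disjoint union of two `G`-sets. -/
def sum (X Y : FinGSet G) : FinGSet G where
  carrier := X.carrier ⊕ Y.carrier

/-- The direct product of two `G`-sets, with the diagonal action. -/
def prod (X Y : FinGSet G) : FinGSet G where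
  carrier := X.carrier × Y.carrier

/-- Transport of a `G`-set along an automorphism `α` of `G`: the same set, with `g` acting as
`α⁻¹ g` did. Up to isomorphism this is the `G`-set `Iso(α) ×_G X`, where `Iso(α)` is the
`(G, G)`-biset `G` with `x · y · g = x y α(g)`. -/
def transport (α : MulAut G) (X : FinGSet G) : FinGSet G where
  carrier := X.carrier
  action := MulAction.compHom X.carrier (α⁻¹ : MulAut G).toMonoidHom

end FinGSet

/-- Isomorphism classes of finite `G`-sets. -/
def GSetClass (G : Type u) [Group G] : Type (u + 1) := Quotient (FinGSet.isoSetoid G)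

namespace GSetClass

variable {G : Type u} [Group G]

/-- The isomorphism class of a finite `G`-set. -/
def mk (X : FinGSet G) : GSetClass G := Quotient.mk _ X

theorem mk_eq {X Y : FinGSet G} (e : X.carrier ≃ Y.carrier)
    (h : ∀ (g : G) (x : X.carrier), e (g • x) = g • e x) : mk X = mk Y :=
  Quotient.sound ⟨⟨e, h⟩⟩

theorem ind {C : GSetClass G → Prop} (h : ∀ X, C (mk X)) (x : GSetClass G) : C x :=
  Quotient.inductionOn x h

instance : Zero (GSetClass G) := ⟨mk (FinGSet.empty G)⟩

instance : One (GSetClass G) := ⟨mk (FinGSet.point G)⟩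

/-- Addition is disjoint union. -/
instance : Add (GSetClass G) where
  add := Quotient.map₂ FinGSet.sum (by
    rintro X X' ⟨e⟩ Y Y' ⟨f⟩
    refine ⟨⟨Equiv.sumCongr e.toEquiv f.toEquiv, ?_⟩⟩
    rintro g (x | y)
    · exact congrArg Sum.inl (e.map_smul g x)
    · exact congrArg Sum.inr (f.map_smul g y))

/-- Multiplication is the direct product. -/
instance : Mul (GSetClass G) where
  mul := Quotient.map₂ FinGSet.prod (by
    rintro X X' ⟨e⟩ Y Y' ⟨f⟩
    refine ⟨⟨Equiv.prodCongr e.toEquiv f.toEquiv, ?_⟩⟩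
    rintro g ⟨x, y⟩
    exact Prod.ext (e.map_smul g x) (f.map_smul g y))

theorem zero_def : (0 : GSetClass G) = mk (FinGSet.empty G) := rfl

theorem one_def : (1 : GSetClass G) = mk (FinGSet.point G) := rfl

theorem mk_add (X Y : FinGSet G) : mk X + mk Y = mk (X.sum Y) := rfl

theorem mk_mul (X Y : FinGSet G) : mk X * mk Y = mk (X.prod Y) := rfl

protected theorem add_comm (x y : GSetClass G) : x + y = y + x := by
  induction x using ind; induction y using ind; rename_i X Y
  exact mk_eq (Equiv.sumComm _ _) (by rintro g (x | y) <;> rfl)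

protected theorem mul_comm (x y : GSetClass G) : x * y = y * x := by
  induction x using ind; induction y using ind; rename_i X Y
  exact mk_eq (Equiv.prodComm _ _) (by rintro g ⟨x, y⟩; rfl)

protected theorem zero_add (x : GSetClass G) : 0 + x = x := by
  induction x using ind; rename_i X
  exact mk_eq (Equiv.emptySum PEmpty _) (by rintro g (x | x); exacts [x.elim, rfl])

protected theorem one_mul (x : GSetClass G) : 1 * x = x := by
  induction x using ind; rename_i X
  exact mk_eq (Equiv.punitProd _) (by rintro g ⟨x, y⟩; rfl)

protected theorem zero_mul (x : GSetClass G) : 0 * x = 0 := by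
  induction x using ind; rename_i X
  exact mk_eq (Equiv.pemptyProd _) (by rintro g ⟨x, y⟩; exact x.elim)

protected theorem right_distrib (x y z : GSetClass G) : (x + y) * z = x * z + y * z := by
  induction x using ind; induction y using ind; induction z using ind; rename_i X Y Z
  exact mk_eq (Equiv.sumProdDistrib _ _ _) (by rintro g ⟨x | y, z⟩ <;> rfl)

instance : CommSemiring (GSetClass G) where
  add_assoc x y z := by
    induction x using ind; induction y using ind; induction z using ind; rename_i X Y Z
    exact mk_eq (Equiv.sumAssoc _ _ _) (by rintro g ((x | y) | z) <;> rfl)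
  zero_add := GSetClass.zero_add
  add_zero x := by rw [GSetClass.add_comm, GSetClass.zero_add]
  add_comm := GSetClass.add_comm
  nsmul := nsmulRec
  mul_assoc x y z := by
    induction x using ind; induction y using ind; induction z using ind; rename_i X Y Z
    exact mk_eq (Equiv.prodAssoc _ _ _) (by rintro g ⟨⟨x, y⟩, z⟩; rfl)
  one_mul := GSetClass.one_mul
  mul_one x := by rw [GSetClass.mul_comm, GSetClass.one_mul]
  mul_comm := GSetClass.mul_comm
  zero_mul := GSetClass.zero_mul
  mul_zero x := by rw [GSetClass.mul_comm, GSetClass.zero_mul]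
  left_distrib x y z := by
    rw [GSetClass.mul_comm, GSetClass.right_distrib, GSetClass.mul_comm y, GSetClass.mul_comm z]
  right_distrib := GSetClass.right_distrib

/-- The number `|X^H|` of `H`-fixed points of a `G`-set `X`, on isomorphism classes. -/
noncomputable def fixedCount (H : Subgroup G) : GSetClass G → ℕ :=
  Quotient.lift (fun X : FinGSet G => Nat.card (MulAction.fixedPoints H X.carrier)) (by
    rintro X Y ⟨e⟩
    refine Nat.card_congr (e.toEquiv.subtypeEquiv fun x => ?_)
    refine forall_congr' fun h => ?_
    change (h : G) • x = x ↔ (h : G) • e.toEquiv x = e.toEquiv x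
    rw [← e.map_smul, e.toEquiv.apply_eq_iff_eq])

theorem fixedCount_mk (H : Subgroup G) (X : FinGSet G) :
    fixedCount H (mk X) = Nat.card (MulAction.fixedPoints H X.carrier) := rfl

/-- Counting `H`-fixed points, as a homomorphism of semirings. -/
noncomputable def fixedCountHom (H : Subgroup G) : GSetClass G →+* ℤ where
  toFun x := fixedCount H x
  map_zero' := by
    rw [zero_def, fixedCount_mk]
    have : IsEmpty (MulAction.fixedPoints H (FinGSet.empty G).carrier) := ⟨fun x => x.1.elim⟩
    simp
  map_one' := by
    rw [one_def, fixedCount_mk]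
    have : Unique (MulAction.fixedPoints H (FinGSet.point G).carrier) :=
      { default := ⟨PUnit.unit, fun _ => rfl⟩
        uniq := fun x => Subtype.ext rfl }
    simp
  map_add' x y := by
    induction x using ind; induction y using ind; rename_i X Y
    rw [mk_add, fixedCount_mk, fixedCount_mk, fixedCount_mk, ← Nat.cast_add, ← Nat.card_sum]
    refine congrArg _ (Nat.card_congr (Equiv.trans (Equiv.subtypeSum) (Equiv.sumCongr ?_ ?_)))
    · refine Equiv.subtypeEquivRight fun x => forall_congr' fun h => ?_
      exact Sum.inl_injective.eq_iff
    · refine Equiv.subtypeEquivRight fun x => forall_congr' fun h => ?_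
      exact Sum.inr_injective.eq_iff
  map_mul' x y := by
    induction x using ind; induction y using ind; rename_i X Y
    rw [mk_mul, fixedCount_mk, fixedCount_mk, fixedCount_mk, ← Nat.cast_mul, ← Nat.card_prod]
    refine congrArg _ (Nat.card_congr (Equiv.trans (Equiv.subtypeEquivRight fun x => ?_)
      (Equiv.subtypeProdEquivProd)))
    exact ⟨fun h => ⟨fun g => congrArg Prod.fst (h g), fun g => congrArg Prod.snd (h g)⟩,
      fun h g => Prod.ext (h.1 g) (h.2 g)⟩

/-- `Aut(G)` acts on isomorphism classes of finite `G`-sets by transport. -/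
instance : MulSemiringAction (MulAut G) (GSetClass G) where
  smul α := Quotient.map (FinGSet.transport α) (by
    rintro X Y ⟨e⟩
    exact ⟨⟨e.toEquiv, fun g x => e.map_smul ((α⁻¹ : MulAut G) g) x⟩⟩)
  one_smul x := by
    induction x using ind
    exact mk_eq (Equiv.refl _) (fun g x => rfl)
  mul_smul α β x := by
    induction x using ind
    exact mk_eq (Equiv.refl _) (fun g x => rfl)
  smul_zero α := mk_eq (Equiv.refl _) (fun g x => rfl)
  smul_one α := mk_eq (Equiv.refl _) (fun g x => rfl)
  smul_add α x y := by
    induction x using ind; induction y using ind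
    exact mk_eq (Equiv.refl _) (by rintro g (x | x) <;> rfl)
  smul_mul α x y := by
    induction x using ind; induction y using ind
    exact mk_eq (Equiv.refl _) (fun g x => rfl)

theorem smul_mk (α : MulAut G) (X : FinGSet G) : α • mk X = mk (X.transport α) := rfl

theorem conj_smul (g : G) (x : GSetClass G) : MulAut.conj g • x = x := by
  induction x using ind; rename_i X
  refine mk_eq (MulAction.toPerm g : Equiv.Perm X.carrier) (fun h (x : X.carrier) => ?_)
  change g • (g⁻¹ * h * g) • x = h • g • x
  simp only [← mul_smul]
  congr 1
  group

end GSetClass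

/-- The Burnside ring `B(G)`: the Grothendieck ring of the category of finite `G`-sets. -/
def BurnsideRing (G : Type u) [Group G] : Type (u + 1) := GrothendieckRing (GSetClass G)

/-- The group of inner automorphisms. -/
def Inn (G : Type u) [Group G] : Subgroup (MulAut G) := (MulAut.conj (G := G)).range

instance (G : Type u) [Group G] : (Inn G).Normal where
  conj_mem := by
    rintro _ ⟨g, rfl⟩ α
    refine ⟨α g, ?_⟩
    ext x
    simp [MulAut.mul_apply]

/-- The outer automorphism group `Out(G) = Aut(G) / Inn(G)`. -/
abbrev Out (G : Type u) [Group G] : Type u := MulAut G ⧸ Inn G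

namespace BurnsideRing

variable {G : Type u} [Group G]

noncomputable instance : CommRing (BurnsideRing G) :=
  inferInstanceAs (CommRing (GrothendieckRing (GSetClass G)))

/-- `Aut(G)` acts on `B(G)` by ring automorphisms, `α • [X] = [Iso(α) ×_G X]`. -/
noncomputable instance : MulSemiringAction (MulAut G) (BurnsideRing G) :=
  inferInstanceAs (MulSemiringAction (MulAut G) (GrothendieckRing (GSetClass G)))

/-- The `H`-component `a ↦ |a^H|` of the ghost map: the ring homomorphism with
`[X] ↦ |X^H|`. -/
noncomputable def mark (H : Subgroup G) : BurnsideRing G →+* ℤ :=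
  GrothendieckRing.lift (GSetClass.fixedCountHom H)

/-- Inner automorphisms act trivially on `B(G)`. -/
theorem inn_smul (α : MulAut G) (hα : α ∈ Inn G) (b : BurnsideRing G) : α • b = b := by
  obtain ⟨g, rfl⟩ := hα
  refine GrothendieckRing.ind (C := fun b => MulAut.conj g • b = b) (fun x y => ?_) b
  rw [GrothendieckRing.smul_mk, GSetClass.conj_smul, GSetClass.conj_smul]

/-- The action of `Out(G)` on `B(G)` by ring automorphisms induced by that of `Aut(G)`. -/
noncomputable instance : MulSemiringAction (Out G) (BurnsideRing G) :=
  MulSemiringAction.compHom (BurnsideRing G)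
    (QuotientGroup.lift (Inn G) (MulSemiringAction.toRingAut (MulAut G) (BurnsideRing G))
      fun α hα => RingEquiv.ext fun b => inn_smul α hα b)

theorem out_mk_smul (α : MulAut G) (b : BurnsideRing G) :
    (QuotientGroup.mk α : Out G) • b = α • b := rfl

/-- The induced action of `Out(G)` on `B(G)ˣ`: `(ω • u : B(G)) = ω • (u : B(G))`. -/
noncomputable instance : MulDistribMulAction (Out G) (BurnsideRing G)ˣ :=
  Units.mulDistribMulActionRight

end BurnsideRing

end Burnside

/-! ## Fusion systems -/

section Fusion

/-- A fusion system on `S`: a category whose objects are the subgroups of `S` and whose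
morphisms are injective group homomorphisms, containing all those induced by conjugation in `S`,
and such that each morphism is an isomorphism of the category followed by an inclusion. -/
structure FusionSystem (S : Type u) [Group S] where
  /-- The morphisms `P → Q` of the fusion system. -/
  Hom (P Q : Subgroup S) : Set (P →* Q)
  injective : ∀ {P Q : Subgroup S} (φ : P →* Q), φ ∈ Hom P Q → Function.Injective φ
  comp_mem : ∀ {P Q R : Subgroup S} (φ : P →* Q) (ψ : Q →* R),
    φ ∈ Hom P Q → ψ ∈ Hom Q R → ψ.comp φ ∈ Hom P R
  /-- `Hom_S(P, Q)` is contained in `Hom P Q`; this includes identities and inclusions. -/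
  conj_mem : ∀ {P Q : Subgroup S} (φ : P →* Q),
    (∃ s : S, ∀ x : P, (φ x : S) = s * x * s⁻¹) → φ ∈ Hom P Q
  exists_factor : ∀ {P Q : Subgroup S} (φ : P →* Q), φ ∈ Hom P Q →
    ∃ (R : Subgroup S) (_ : R ≤ Q) (ψ : P ≃* R), ψ.toMonoidHom ∈ Hom P R ∧
      ψ.symm.toMonoidHom ∈ Hom R P ∧ ∀ x : P, (φ x : S) = ψ x

/-- The automorphisms of `P ≤ S` induced by conjugation in `S`, that is `Aut_S(P)`. -/
def autConj {S : Type u} [Group S] (P : Subgroup S) : Subgroup (MulAut P) :=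
  P.normalizerMonoidHom.range

/-- A subgroup `H` of a finite group `G` is strongly `p`-embedded if it is proper, `p` divides
`|H|`, and `p` does not divide `|H ∩ xHx⁻¹|` for any `x ∈ G \ H`. -/
def IsStronglyEmbedded (p : ℕ) {G : Type u} [Group G] (H : Subgroup G) : Prop :=
  H < ⊤ ∧ p ∣ Nat.card H ∧
    ∀ x : G, x ∉ H → ¬ p ∣ Nat.card (H ⊓ H.map (MulAut.conj x).toMonoidHom : Subgroup G)

namespace FusionSystem

variable {S : Type u} [Group S] (F : FusionSystem S)

/-- `φ : P ≃ Q` is an isomorphism of the category `F`. -/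
def IsIso {P Q : Subgroup S} (φ : P ≃* Q) : Prop :=
  φ.toMonoidHom ∈ F.Hom P Q ∧ φ.symm.toMonoidHom ∈ F.Hom Q P

/-- `P` and `Q` are `F`-conjugate, i.e. isomorphic in `F`. -/
def IsConj (P Q : Subgroup S) : Prop := ∃ φ : P ≃* Q, F.IsIso φ

/-- The group `Aut_F(P) = Hom_F(P, P)`. -/
def aut (P : Subgroup S) : Subgroup (MulAut P) where
  carrier := {α | α.toMonoidHom ∈ F.Hom P P}
  one_mem' := F.conj_mem _ ⟨1, fun x => by simp⟩
  mul_mem' {α β} hα hβ := F.comp_mem β.toMonoidHom α.toMonoidHom hβ hα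
  inv_mem' {α} hα := by
    obtain ⟨R, hR, ψ, -, hψ', h⟩ := F.exists_factor _ hα
    have hPR : P ≤ R := fun x hx => by
      have := h (α⁻¹ ⟨x, hx⟩)
      have h2 : (α.toMonoidHom (α⁻¹ ⟨x, hx⟩) : S) = x :=
        congrArg Subtype.val (α.apply_symm_apply ⟨x, hx⟩)
      rw [h2] at this
      rw [this]
      exact (ψ _).2
    have hincl : Subgroup.inclusion hPR ∈ F.Hom P R := F.conj_mem _ ⟨1, fun x => by simp⟩
    have := F.comp_mem _ _ hincl hψ'
    have heq : (ψ.symm.toMonoidHom.comp (Subgroup.inclusion hPR)) = (α⁻¹).toMonoidHom := by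
      ext1 x
      change ψ.symm (Subgroup.inclusion hPR x) = α⁻¹ x
      rw [MulEquiv.symm_apply_eq]
      apply Subtype.ext
      rw [← h]
      exact (congrArg Subtype.val (α.apply_symm_apply x)).symm
    rwa [heq] at this

theorem mem_aut {P : Subgroup S} (α : MulAut P) : α ∈ F.aut P ↔ α.toMonoidHom ∈ F.Hom P P :=
  Iff.rfl

/-- The group `Out_F(P) = Aut_F(P) / Inn(P)`, as a subgroup of `Out(P)`. -/
def out (P : Subgroup S) : Subgroup (Out P) := (F.aut P).map (QuotientGroup.mk' (Inn P))

/-- The group `Out_F(S)`, as a subgroup of `Out(S)`; here `Aut_F(S)` is transported from the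
subgroup `⊤` of `S` to the group `S` itself. -/
def outS : Subgroup (Out S) :=
  ((F.aut ⊤).map (MulAut.congr (Subgroup.topEquiv (G := S))).toMonoidHom).map
    (QuotientGroup.mk' (Inn S))

/-- `P` is fully automized if `Aut_S(P)` is a Sylow `p`-subgroup of `Aut_F(P)`. -/
def FullyAutomized (p : ℕ) (P : Subgroup S) : Prop :=
  ∃ T : Sylow p (F.aut P), (T : Subgroup (F.aut P)) = (autConj P).subgroupOf (F.aut P)

/-- For an isomorphism `φ : Q ≃ P`, the subgroup `N_φ` of all `g ∈ N_S(Q)` such that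
`φ c_g φ⁻¹ ∈ Aut_S(P)`. -/
def extender {Q P : Subgroup S} (φ : Q ≃* P) : Subgroup S :=
  ((autConj P).comap ((MulAut.congr φ).toMonoidHom.comp Q.normalizerMonoidHom)).map
    (Subgroup.normalizer (Q : Set S)).subtype

/-- `P` is receptive if each `φ ∈ Iso_F(Q, P)` extends to a morphism `N_φ → S` of `F`. -/
def Receptive (P : Subgroup S) : Prop :=
  ∀ (Q : Subgroup S) (φ : Q ≃* P), F.IsIso φ →
    ∃ ψ ∈ F.Hom (extender φ) ⊤, ∀ (x : extender φ) (hx : (x : S) ∈ Q),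
      (ψ x : S) = φ ⟨x, hx⟩

/-- A fusion system is saturated if each subgroup of `S` is `F`-conjugate to one which is fully
automized and receptive. -/
def IsSaturated (p : ℕ) : Prop :=
  ∀ P : Subgroup S, ∃ Q : Subgroup S, F.IsConj P Q ∧ F.FullyAutomized p Q ∧ F.Receptive Q

/-- `P` is `F`-centric if `C_S(Q) ≤ Q` for each `F`-conjugate `Q` of `P`. -/
def IsCentric (P : Subgroup S) : Prop :=
  ∀ Q : Subgroup S, F.IsConj P Q → Subgroup.centralizer (Q : Set S) ≤ Q

/-- `P` is fully normalized if `|N_S(P)| ≥ |N_S(Q)|` for each `F`-conjugate `Q` of `P`. -/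
def FullyNormalized (P : Subgroup S) : Prop :=
  ∀ Q : Subgroup S, F.IsConj P Q →
    Nat.card (Subgroup.normalizer (Q : Set S)) ≤ Nat.card (Subgroup.normalizer (P : Set S))

/-- `P` is `F`-essential if it is `F`-centric and fully normalized, and `Out_F(P)` contains a
strongly `p`-embedded subgroup. -/
def IsEssential (p : ℕ) (P : Subgroup S) : Prop :=
  F.IsCentric P ∧ F.FullyNormalized P ∧ ∃ H : Subgroup (F.out P), IsStronglyEmbedded p H

/-- The Burnside ring `B(F)`: the subring of all `a ∈ B(S)` such that `|a^P| = |a^Q|` whenever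
`P` and `Q` are isomorphic in `F`. -/
noncomputable def burnsideRing : Subring (BurnsideRing S) where
  carrier := {a | ∀ P Q : Subgroup S, F.IsConj P Q →
    BurnsideRing.mark P a = BurnsideRing.mark Q a}
  zero_mem' _ _ _ := by simp only [map_zero]
  one_mem' _ _ _ := by simp only [map_one]
  add_mem' ha hb P Q h := by simp only [map_add, ha P Q h, hb P Q h]
  mul_mem' ha hb P Q h := by simp only [map_mul, ha P Q h, hb P Q h]
  neg_mem' ha P Q h := by simp only [map_neg, ha P Q h]

/-- The unit group of `B(F)`, as a subgroup of `B(S)ˣ`. -/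
noncomputable def burnsideUnits : Subgroup (BurnsideRing S)ˣ :=
  (Units.map (F.burnsideRing.subtype : F.burnsideRing →* BurnsideRing S)).range

end FusionSystem

end Fusion

/-! Marks separate the points of B(S), and the mark of α·a at P is the mark of a at α⁻¹(P). So a
unit is fixed by Out_F(S) exactly when its marks at P and α(P) agree for all P and all α in
Aut_F(S). Such an α restricts to an F-isomorphism P → α(P), so units of B(F) are fixed. The converse
needs every F-isomorphism to be a restriction of an element of Aut_F(S); this is Alperin's fusion
theorem without proper essential subgroups (`extends_of_no_essential`).

That is proved by induction from large subgroups to small ones. Choose Q fully automized and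
receptive in the class of P. Each conjugate R of P is carried onto Q by a morphism defined on N_S(R)
> R (`exists_normalizer_hom`), which by induction comes from Aut_F(S); it remains to treat Aut_F(Q)
(`extends_of_receptive`). If Q is not centric, every automorphism of Q in F extends to a larger
subgroup, and induction applies. If Q is centric and some automorphism did not extend to S, the
extendable ones would have strongly p-embedded image in Out_F(Q), making Q essential. -/

/-! ### Finite G-sets and Burnside ring elements are determined by their marks. -/

namespace GSetClass

variable {G : Type u} [Group G]

/-- The transitive `G`-set `G/H`. -/
def cosets [Finite G] (H : Subgroup G) : FinGSet G where
  carrier := G ⧸ H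

/-- Split X into the orbit of x, which is G/Stab(x), and its invariant complement. -/
theorem exists_eq_cosets_add [Finite G] (X : FinGSet G) (x : X.carrier) :
    ∃ Y : FinGSet G, mk X = mk (cosets (MulAction.stabilizer G x)) + mk Y := by
  classical
  let C : SubMulAction G X.carrier :=
    { carrier := (MulAction.orbit G x)ᶜ
      smul_mem' := fun g y hy h => hy (by
        obtain ⟨k, hk⟩ := h
        exact ⟨g⁻¹ * k, by
          change k • x = g • y at hk
          change (g⁻¹ * k) • x = y
          rw [mul_smul, hk, inv_smul_smul]⟩) }
  refine ⟨⟨C⟩, ?_⟩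
  rw [mk_add]
  symm
  refine mk_eq (Equiv.trans (Equiv.sumCongr
    (MulAction.orbitEquivQuotientStabilizer G x).symm (Equiv.refl _))
    (Equiv.Set.sumCompl (MulAction.orbit G x))) ?_
  rintro g (y | y)
  · induction y using QuotientGroup.induction_on with
    | H a => exact mul_smul g a x
  · rfl

theorem fixedCount_add (H : Subgroup G) (a b : GSetClass G) :
    fixedCount H (a + b) = fixedCount H a + fixedCount H b := by
  exact Nat.cast_injective (R := ℤ)
    (((fixedCountHom H).map_add a b).trans (Nat.cast_add _ _).symm)

theorem fixedCount_pos_iff (H : Subgroup G) (X : FinGSet G) :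
    0 < fixedCount H (mk X) ↔ ∃ x : X.carrier, H ≤ MulAction.stabilizer G x := by
  rw [fixedCount_mk, Nat.card_pos_iff]
  constructor
  · rintro ⟨⟨x⟩, -⟩
    exact ⟨x.1, fun h hh => x.2 ⟨h, hh⟩⟩
  · rintro ⟨x, hx⟩
    exact ⟨⟨x, fun h => hx h.2⟩, inferInstance⟩

/-- Induction on |X|, the count at the trivial subgroup: a maximal H having fixed points is the full
stabilizer of any point it fixes, both in X and in any set with the same counts. Hence G/H can be
cancelled from both sides. -/
theorem eq_of_fixedCount_eq [Finite G] (a b : GSetClass G)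
    (h : ∀ H, fixedCount H a = fixedCount H b) : a = b := by
  induction hn : fixedCount ⊥ a using Nat.strong_induction_on generalizing a b with
  | _ n ih =>
  induction a using ind with | _ X => ?_
  induction b using ind with | _ Y => ?_
  by_cases hX : Nonempty X.carrier
  · obtain ⟨H, hH⟩ := Set.Finite.exists_maximal
      (s := {H : Subgroup G | 0 < fixedCount H (mk X)}) (Set.toFinite _)
      ⟨⊥, (fixedCount_pos_iff _ _).2 ⟨hX.some, bot_le⟩⟩
    have key : ∀ Z : FinGSet G, (∀ K, fixedCount K (mk X) = fixedCount K (mk Z)) →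
        ∃ W, mk Z = mk (cosets H) + mk W := by
      intro Z hZ
      obtain ⟨z, hz⟩ := (fixedCount_pos_iff H Z).1 (hZ H ▸ hH.1)
      have hz' : H = MulAction.stabilizer G z :=
        le_antisymm hz (hH.2 (show 0 < fixedCount _ (mk X) from
          hZ _ ▸ (fixedCount_pos_iff _ _).2 ⟨z, le_rfl⟩) hz)
      subst hz'
      exact exists_eq_cosets_add Z z
    obtain ⟨X', hX'⟩ := key X fun _ => rfl
    obtain ⟨Y', hY'⟩ := key Y h
    rw [hX', hY']
    rw [hX', hY'] at h
    simp only [fixedCount_add, add_right_inj] at h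
    have hpos : 0 < fixedCount ⊥ (mk (cosets H)) :=
      (fixedCount_pos_iff _ _).2 ⟨((1 : G) : G ⧸ H), bot_le⟩
    rw [ih (fixedCount ⊥ (mk X')) (by rw [← hn, hX', fixedCount_add]; omega) _ _ h rfl]
  · have hY : ¬ Nonempty Y.carrier := fun ⟨y⟩ => by
      have := (fixedCount_pos_iff ⊥ Y).2 ⟨y, bot_le⟩
      rw [← h, fixedCount_pos_iff] at this
      exact hX ⟨this.choose⟩
    rw [not_nonempty_iff] at hX hY
    exact mk_eq (Equiv.equivOfIsEmpty _ _) fun _ x => hX.elim x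

theorem fixedCount_smul (α : MulAut G) (H : Subgroup G) (a : GSetClass G) :
    fixedCount H (α • a) = fixedCount (H.map (α⁻¹ : MulAut G).toMonoidHom) a := by
  induction a using ind with | _ X => ?_
  rw [smul_mk, fixedCount_mk, fixedCount_mk]
  refine Nat.card_congr (Equiv.subtypeEquivRight fun x => ?_)
  constructor
  · rintro h ⟨_, g, hg, rfl⟩
    exact h ⟨g, hg⟩
  · rintro h ⟨g, hg⟩
    exact h ⟨_, g, hg, rfl⟩

end GSetClass

namespace BurnsideRing

variable {G : Type u} [Group G]

theorem mark_mk (H : Subgroup G) (a b : GSetClass G) :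
    mark H (GrothendieckRing.mk a b) = GSetClass.fixedCount H a - GSetClass.fixedCount H b := rfl

/-- Burnside's theorem: an element of the Burnside ring is determined by its marks. -/
theorem ext_mark [Finite G] (x y : BurnsideRing G) (h : ∀ H, mark H x = mark H y) : x = y := by
  induction x using GrothendieckRing.ind with | _ a b => ?_
  induction y using GrothendieckRing.ind with | _ c d => ?_
  refine GrothendieckRing.mk_eq_iff.2 ⟨0, ?_⟩
  rw [GSetClass.eq_of_fixedCount_eq (a + d) (c + b)]
  intro H
  have := h H
  rw [mark_mk, mark_mk] at this
  rw [GSetClass.fixedCount_add, GSetClass.fixedCount_add]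
  omega

theorem mark_smul (α : MulAut G) (H : Subgroup G) (x : BurnsideRing G) :
    mark H (α • x) = mark (H.map (α⁻¹ : MulAut G).toMonoidHom) x := by
  induction x using GrothendieckRing.ind with | _ a b => ?_
  refine (mark_mk H (α • a) (α • b)).trans ?_
  rw [mark_mk, GSetClass.fixedCount_smul, GSetClass.fixedCount_smul]

end BurnsideRing

/-! ### Sylow conjugation and strongly p-embedded subgroups. -/

theorem IsPGroup.exists_conj_mem_sylow {p : ℕ} [Fact p.Prime] {G : Type u} [Group G] [Finite G]
    (T : Sylow p G) {Y : Subgroup G} (hY : IsPGroup p Y) :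
    ∃ k : G, ∀ y ∈ Y, k * y * k⁻¹ ∈ T := by
  obtain ⟨U, hU⟩ := hY.exists_le_sylow
  obtain ⟨k, hk⟩ := MulAction.exists_smul_eq G U T
  refine ⟨k, fun y hy => ?_⟩
  rw [← hk]
  exact ⟨y, hU hy, rfl⟩

/-- T is also Sylow in K, so Sylow's theorem inside K gives a conjugating element in K. -/
theorem exists_conj_mem_sylow_of_le {p : ℕ} [Fact p.Prime] {G : Type u} [Group G] [Finite G]
    (T : Sylow p G) {K : Subgroup G} (hT : (T : Subgroup G) ≤ K) {y : G} (hy : y ∈ K)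
    {n : ℕ} (hyp : y ^ p ^ n = 1) : ∃ k ∈ K, k * y * k⁻¹ ∈ T := by
  have hp : IsPGroup p (Subgroup.zpowers (⟨y, hy⟩ : K)) := by
    rintro ⟨_, m, rfl⟩
    refine ⟨n, Subtype.ext (Subtype.ext ?_)⟩
    change (y ^ m) ^ p ^ n = 1
    rw [← zpow_natCast, ← zpow_mul, mul_comm, zpow_mul, zpow_natCast, hyp, one_zpow]
  obtain ⟨k, hk⟩ := hp.exists_conj_mem_sylow (T.subtype hT)
  exact ⟨k, k.2, hk _ (Subgroup.mem_zpowers _)⟩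

/-- A criterion for the image of `K` in a quotient of `A` to be strongly `p`-embedded. -/
theorem isStronglyEmbedded_map {p : ℕ} [Fact p.Prime] {A G : Type u} [Group A] [Group G] [Finite A]
    (f : A →* G) (hf : Function.Surjective f) (hker : IsPGroup p f.ker) (T : Sylow p A)
    (hTf : ¬ (T : Subgroup A) ≤ f.ker) (K : Subgroup A) (hTK : (T : Subgroup A) ≤ K)
    (hkK : f.ker ≤ K) (hK : K ≠ ⊤)
    (h : ∀ z t : A, t ∈ T → t ∉ f.ker → z * t * z⁻¹ ∈ T → z ∈ K) :
    IsStronglyEmbedded p (K.map f) := by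
  have hp : p.Prime := Fact.out
  have : Finite G := Finite.of_surjective f hf
  have hmem : ∀ {x}, f x ∈ K.map f ↔ x ∈ K := by
    intro x
    rw [← Subgroup.mem_comap, Subgroup.comap_map_eq, sup_eq_left.2 hkK]
  refine ⟨lt_top_iff_ne_top.2 fun e => hK (eq_top_iff.2 fun x _ =>
    hmem.1 (e ▸ Subgroup.mem_top _)), ?_, ?_⟩
  · obtain ⟨t, ht, htf⟩ := SetLike.not_le_iff_exists.1 hTf
    obtain ⟨n, hn⟩ := T.isPGroup' ⟨t, ht⟩
    have h1 : f t ^ p ^ n = 1 := by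
      rw [← map_pow, show t ^ p ^ n = 1 from congrArg Subtype.val hn, map_one]
    obtain ⟨m, -, hm⟩ := (Nat.dvd_prime_pow hp).1 (orderOf_dvd_of_pow_eq_one h1)
    have hm0 : m ≠ 0 := by
      rintro rfl
      exact htf (orderOf_eq_one_iff.1 (by simpa using hm))
    exact ((dvd_pow_self p hm0).trans hm.symm.dvd).trans
      (Subgroup.orderOf_dvd_natCard _ (Subgroup.mem_map_of_mem f (hTK ht)))
  · intro x hx hdvd
    obtain ⟨x, rfl⟩ := hf x
    rw [hmem] at hx
    -- By Cauchy the intersection has an element f(y) of order p, with y and x⁻¹yx both in K. As the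
    -- kernel is a p-group, y is a p-element; so both can be conjugated into T within K, and `h`
    -- applies to the resulting pair.
    obtain ⟨⟨w, hw1, hw2⟩, hw⟩ := exists_prime_orderOf_dvd_card' p hdvd
    obtain ⟨y, hy, rfl⟩ := hw1
    obtain ⟨_, ⟨y', hy', rfl⟩, hyy'⟩ := hw2
    have hxy : x⁻¹ * y * x ∈ K := by
      rw [← hmem]
      have : f (x⁻¹ * y * x) = f y' := by
        rw [map_mul, map_mul, ← hyy', map_inv]
        simp [mul_assoc]
      rw [this]
      exact Subgroup.mem_map_of_mem f hy'
    rw [← Subgroup.orderOf_coe] at hw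
    change orderOf (f y) = p at hw
    have hyp : y ^ p ∈ f.ker := by
      rw [MonoidHom.mem_ker, map_pow, ← hw, pow_orderOf_eq_one]
    have hyk : y ∉ f.ker := fun hy => by
      rw [MonoidHom.mem_ker.1 hy, orderOf_one] at hw
      exact hp.one_lt.ne hw
    obtain ⟨n, hn⟩ := hker ⟨_, hyp⟩
    have hn' : y ^ p ^ (n + 1) = 1 := by
      rw [pow_succ', pow_mul]
      exact congrArg Subtype.val hn
    have hn'' : (x⁻¹ * y * x) ^ p ^ (n + 1) = 1 := by
      have := conj_pow (i := p ^ (n + 1)) (a := x⁻¹) (b := y)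
      rw [inv_inv] at this
      rw [this, hn']
      simp
    obtain ⟨k, hk, hkT⟩ := exists_conj_mem_sylow_of_le T hTK hy hn'
    obtain ⟨l, hl, hlT⟩ := exists_conj_mem_sylow_of_le T hTK hxy hn''
    have hz : l * x⁻¹ * k⁻¹ ∈ K := by
      refine h _ (k * y * k⁻¹) hkT (fun hmk => hyk ?_) ?_
      · have := (MonoidHom.normal_ker f).conj_mem _ hmk k⁻¹
        simpa [mul_assoc] using this
      · convert hlT using 1
        group
    apply hx
    have : x = k⁻¹ * (l * x⁻¹ * k⁻¹)⁻¹ * l := by group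
    rw [this]
    exact K.mul_mem (K.mul_mem (K.inv_mem hk) (K.inv_mem hz)) hl

/-! ### Morphisms of a fusion system, Aut_F(S) and extenders. -/

theorem mem_autConj {S : Type u} [Group S] {P : Subgroup S} {χ : MulAut P} :
    χ ∈ autConj P ↔ ∃ g ∈ Subgroup.normalizer (P : Set S), ∀ x : P, (χ x : S) = g * x * g⁻¹ := by
  constructor
  · rintro ⟨g, rfl⟩
    exact ⟨g, g.2, fun x => rfl⟩
  · rintro ⟨g, hg, h⟩
    exact ⟨⟨g, hg⟩, MulEquiv.ext fun x => Subtype.ext (h x).symm⟩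

namespace FusionSystem

variable {S : Type u} [Group S] (F : FusionSystem S)

variable {F} in
-- Membership in `F.Hom` depends only on the underlying map into S: a morphism factors through its
-- image, which includes into any codomain containing it.
theorem mem_of_val_eq {P Q R : Subgroup S} {φ : P →* Q} (hφ : φ ∈ F.Hom P Q) (φ' : P →* R)
    (h : ∀ x, (φ' x : S) = φ x) : φ' ∈ F.Hom P R := by
  obtain ⟨R₀, -, ψ, hψ, -, hv⟩ := F.exists_factor φ hφ
  have hle : R₀ ≤ R := fun y hy => by
    have := hv (ψ.symm ⟨y, hy⟩)
    rw [ψ.apply_symm_apply, ← h] at this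
    change _ = y at this
    exact this ▸ (φ' _).2
  have := F.comp_mem _ (Subgroup.inclusion hle) hψ (F.conj_mem _ ⟨1, fun x => by simp⟩)
  convert this using 1
  ext x
  exact (h x).trans (hv x)

variable {F} in
theorem isIso_of_mem {P Q : Subgroup S} {φ : P ≃* Q} (hφ : φ.toMonoidHom ∈ F.Hom P Q) :
    F.IsIso φ := by
  refine ⟨hφ, ?_⟩
  obtain ⟨R₀, -, ψ, -, hψ, hv⟩ := F.exists_factor _ hφ
  have hv' : ∀ x, (φ x : S) = ψ x := hv
  have hle : Q ≤ R₀ := fun y hy => by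
    have := hv' (φ.symm ⟨y, hy⟩)
    rw [φ.apply_symm_apply] at this
    change y = _ at this
    exact this ▸ (ψ _).2
  have := F.comp_mem (Subgroup.inclusion hle) _ (F.conj_mem _ ⟨1, fun x => by simp⟩) hψ
  convert this using 1
  ext1 y
  obtain ⟨x, rfl⟩ := φ.surjective y
  change φ.symm (φ x) = ψ.symm (Subgroup.inclusion hle (φ x))
  rw [φ.symm_apply_apply, MulEquiv.eq_symm_apply]
  exact Subtype.ext (hv' x).symm

variable {F} in
theorem IsIso.trans {P Q R : Subgroup S} {φ : P ≃* Q} {ψ : Q ≃* R} (hφ : F.IsIso φ)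
    (hψ : F.IsIso ψ) : F.IsIso (φ.trans ψ) :=
  ⟨F.comp_mem _ _ hφ.1 hψ.1, F.comp_mem _ _ hψ.2 hφ.2⟩

variable {F} in
theorem IsIso.symm {P Q : Subgroup S} {φ : P ≃* Q} (hφ : F.IsIso φ) : F.IsIso φ.symm :=
  ⟨hφ.2, hφ.1⟩

/-- The group `Aut_F(S)`, as a group of automorphisms of `S` itself. -/
def autS : Subgroup (MulAut S) :=
  (F.aut ⊤).map (MulAut.congr (Subgroup.topEquiv (G := S))).toMonoidHom

variable {F} in
theorem mem_of_mem_autS {α : MulAut S} (hα : α ∈ F.autS) {P Q : Subgroup S} (φ : P →* Q)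
    (h : ∀ x, (φ x : S) = α x) : φ ∈ F.Hom P Q := by
  obtain ⟨β, hβ, rfl⟩ := hα
  have := F.comp_mem (Subgroup.inclusion (le_top : P ≤ ⊤)) _
    (F.conj_mem _ ⟨1, fun x => by simp⟩) hβ
  exact mem_of_val_eq this φ h

variable {F} in
theorem mem_autS_of_mem {φ : (⊤ : Subgroup S) →* (⊤ : Subgroup S)} (hφ : φ ∈ F.Hom ⊤ ⊤)
    (α : MulAut S) (h : ∀ x, (φ x : S) = α x) : α ∈ F.autS := by
  refine ⟨(MulAut.congr (Subgroup.topEquiv (G := S))).symm α, ?_, ?_⟩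
  · exact mem_of_val_eq hφ _ fun x => (h x).symm
  · exact MulEquiv.apply_symm_apply _ _

theorem conj_mem_autS (g : S) : MulAut.conj g ∈ F.autS := by
  refine mem_autS_of_mem (φ := ((MulAut.congr (Subgroup.topEquiv (G := S))).symm
    (MulAut.conj g)).toMonoidHom) (F.conj_mem _ ⟨g, fun x => rfl⟩) _ fun x => rfl

theorem isConj_map {α : MulAut S} (hα : α ∈ F.autS) (P : Subgroup S) :
    F.IsConj P (P.map α.toMonoidHom) :=
  ⟨α.subgroupMap P, isIso_of_mem (mem_of_mem_autS hα _ fun _ => rfl)⟩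

/-- The conjugate of x enters as a separate element y of Q, so that uses need not mention the
conjugation automorphism of Q. -/
theorem mem_extender {Q P : Subgroup S} {φ : Q ≃* P} {g : S} :
    g ∈ extender φ ↔ g ∈ Subgroup.normalizer (Q : Set S) ∧
      ∃ h ∈ Subgroup.normalizer (P : Set S),
        ∀ x y : Q, (y : S) = g * x * g⁻¹ → (φ y : S) = h * φ x * h⁻¹ := by
  constructor
  · rintro ⟨⟨g, hg⟩, hm, rfl⟩
    obtain ⟨h, hh, hx⟩ := mem_autConj.1 hm
    refine ⟨hg, h, hh, fun x y hy => ?_⟩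
    rw [← hx (φ x)]
    change _ = (φ (Q.normalizerMonoidHom ⟨g, hg⟩ (φ.symm (φ x))) : S)
    rw [φ.symm_apply_apply]
    congr 2
    exact Subtype.ext hy
  · rintro ⟨hg, h, hh, hx⟩
    refine ⟨⟨g, hg⟩, mem_autConj.2 ⟨h, hh, fun z => ?_⟩, rfl⟩
    obtain ⟨x, rfl⟩ := φ.surjective z
    rw [← hx x (Q.normalizerMonoidHom ⟨g, hg⟩ x) rfl]
    change (φ (Q.normalizerMonoidHom ⟨g, hg⟩ (φ.symm (φ x))) : S) = _
    rw [φ.symm_apply_apply]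

theorem le_extender {Q P : Subgroup S} (φ : Q ≃* P) : Q ≤ extender φ := by
  intro g hg
  refine mem_extender.2 ⟨Subgroup.le_normalizer hg, φ ⟨g, hg⟩, Subgroup.le_normalizer (φ _).2,
    fun x y hy => ?_⟩
  have : y = ⟨g, hg⟩ * x * ⟨g, hg⟩⁻¹ := Subtype.ext hy
  rw [this]
  simp

/-- An element of C_S(Q) induces the identity on Q, so it lies in N_φ for every φ, with h = 1. -/
theorem centralizer_le_extender {Q P : Subgroup S} (φ : Q ≃* P) :
    Subgroup.centralizer (Q : Set S) ≤ extender φ := by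
  intro g hg
  refine mem_extender.2 ⟨Subgroup.centralizer_le_normalizer _ hg, 1, one_mem _, fun x y hy => ?_⟩
  have : y = x := Subtype.ext (by
    rw [hy, ← Subgroup.mem_centralizer_iff.1 hg x x.2, mul_inv_cancel_right])
  simp [this]

/-! ### Extending morphisms to automorphisms of S. -/

/-- `φ` is the restriction of an element of `Aut_F(S)`. -/
def Extends {P Q : Subgroup S} (φ : P →* Q) : Prop := ∃ α ∈ F.autS, ∀ x : P, (φ x : S) = α x

variable {F} in
-- An isomorphism R → Q turns Aut_S(R) into a p-subgroup of Aut_F(Q). Composing with an element of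
-- Aut_F(Q) moves that subgroup into the Sylow subgroup Aut_S(Q); the extender is then all of
-- N_S(R), and receptivity applies. The last two clauses say that ψ maps R onto Q and nothing else
-- into Q.
theorem exists_normalizer_hom {p : ℕ} [Fact p.Prime] [Finite S] (hS : IsPGroup p S)
    {Q R : Subgroup S} (hA : F.FullyAutomized p Q) (hR : F.Receptive Q) (hRQ : F.IsConj R Q) :
    ∃ ψ ∈ F.Hom (Subgroup.normalizer (R : Set S)) ⊤,
      (∀ x, (ψ x : S) ∈ Q ↔ (x : S) ∈ R) ∧ ∀ y ∈ Q, ∃ x, (ψ x : S) = y := by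
  obtain ⟨φ₀, hφ₀⟩ := hRQ
  obtain ⟨T, hT⟩ := hA
  have : Finite (MulAut Q) := Finite.of_injective (fun α : MulAut Q => (α : Q → Q))
    DFunLike.coe_injective
  have hmem : ∀ g : Subgroup.normalizer (R : Set S),
      MulAut.congr φ₀ (R.normalizerMonoidHom g) ∈ F.aut Q := by
    intro g
    exact F.comp_mem _ _ (F.comp_mem _ (R.normalizerMonoidHom g).toMonoidHom hφ₀.2
      (F.conj_mem _ ⟨g, fun x => rfl⟩)) hφ₀.1
  let f : Subgroup.normalizer (R : Set S) →* F.aut Q :=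
    ((MulAut.congr φ₀).toMonoidHom.comp R.normalizerMonoidHom).codRestrict _ hmem
  have hp : IsPGroup p f.range :=
    (hS.to_subgroup _).of_surjective f.rangeRestrict f.rangeRestrict_surjective
  obtain ⟨k, hk⟩ := hp.exists_conj_mem_sylow T
  let φ : R ≃* Q := φ₀.trans (k : MulAut Q)
  have hφ : F.IsIso φ := hφ₀.trans (isIso_of_mem k.2)
  have hext : extender φ = Subgroup.normalizer (R : Set S) := by
    refine le_antisymm (fun g hg => (mem_extender.1 hg).1) fun g hg => ?_
    have h1 : k * f ⟨g, hg⟩ * k⁻¹ ∈ (T : Subgroup (F.aut Q)) := hk _ ⟨_, rfl⟩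
    rw [hT, Subgroup.mem_subgroupOf] at h1
    exact ⟨⟨g, hg⟩, h1, rfl⟩
  obtain ⟨ψ, hψ, hv⟩ := hR R φ hφ
  rw [← hext]
  refine ⟨ψ, hψ, fun x => ⟨fun hx => ?_, fun hx => ?_⟩, fun y hy => ?_⟩
  · obtain ⟨y, hy⟩ := φ.surjective ⟨_, hx⟩
    have := hv ⟨y, le_extender φ y.2⟩ y.2
    rw [show φ ⟨_, y.2⟩ = _ from hy] at this
    rw [← F.injective ψ hψ (Subtype.ext this)]
    exact y.2
  · rw [hv x hx]
    exact (φ _).2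
  · obtain ⟨x, hx⟩ := φ.surjective ⟨y, hy⟩
    exact ⟨⟨x, le_extender φ x.2⟩, (hv _ x.2).trans (congrArg Subtype.val hx)⟩

variable {F} in
-- The morphism on N_S(R) that carries R onto Q embeds N_S(R) into N_S(Q).
theorem FullyAutomized.fullyNormalized {p : ℕ} [Fact p.Prime] [Finite S] (hS : IsPGroup p S)
    {Q : Subgroup S} (hA : F.FullyAutomized p Q) (hR : F.Receptive Q) : F.FullyNormalized Q := by
  rintro R ⟨φ, hφ⟩
  obtain ⟨ψ, hψ, h, hs⟩ := exists_normalizer_hom hS hA hR ⟨φ.symm, hφ.symm⟩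
  have hN : ∀ x, (ψ x : S) ∈ Subgroup.normalizer (Q : Set S) := by
    intro x
    refine Subgroup.mem_normalizer_fintype fun n hn => ?_
    obtain ⟨r, rfl⟩ := hs n hn
    have : (ψ x : S) * ψ r * (ψ x : S)⁻¹ = ψ (x * r * x⁻¹) := by simp
    rw [this]
    exact (h _).2 ((Subgroup.mem_normalizer_iff.1 x.2 _).1 ((h r).1 hn))
  exact Nat.card_le_card_of_injective (fun x => (⟨ψ x, hN x⟩ : Subgroup.normalizer (Q : Set S)))
    fun x y hxy => F.injective ψ hψ (Subtype.ext (by simpa only [Subtype.mk.injEq] using hxy))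

variable {F} in
-- The element g makes N_χ strictly larger than Q; receptivity extends χ to N_χ, and the induction
-- hypothesis extends it from there to S.
theorem Receptive.extends_of_mem_extender [Finite S] {Q : Subgroup S} (hR : F.Receptive Q)
    (ih : ∀ R : Subgroup S, Q < R → ∀ φ ∈ F.Hom R ⊤, F.Extends φ) {χ : MulAut Q}
    (hχ : χ ∈ F.aut Q) {g : S} (hg : g ∈ extender χ) (hgQ : g ∉ Q) :
    F.Extends χ.toMonoidHom := by
  obtain ⟨ψ, hψ, hv⟩ := hR Q χ (isIso_of_mem hχ)
  obtain ⟨α, hα, h⟩ := ih _ (SetLike.lt_iff_le_and_exists.2 ⟨le_extender χ, g, hg, hgQ⟩) ψ hψ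
  exact ⟨α, hα, fun x => (hv ⟨x, le_extender χ x.2⟩ x.2).symm.trans (h _)⟩

/-- The automorphisms of `Q` in `F` that are restrictions of elements of `Aut_F(S)`. -/
def extendable (Q : Subgroup S) : Subgroup (F.aut Q) where
  carrier := {χ | F.Extends (χ : MulAut Q).toMonoidHom}
  one_mem' := ⟨1, one_mem _, fun _ => rfl⟩
  mul_mem' := by
    rintro χ χ' ⟨α, hα, h⟩ ⟨β, hβ, h'⟩
    exact ⟨α * β, mul_mem hα hβ, fun x => (h _).trans (congrArg α (h' x))⟩
  inv_mem' := by
    rintro χ ⟨α, hα, h⟩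
    refine ⟨α⁻¹, inv_mem hα, fun x => ?_⟩
    obtain ⟨y, rfl⟩ := (χ : MulAut Q).surjective x
    refine (congrArg Subtype.val ((χ : MulAut Q).symm_apply_apply y)).trans ?_
    rw [show ((χ : MulAut Q) y : S) = α y from h y]
    exact (α.symm_apply_apply _).symm

variable {F} in
theorem mem_extendable {Q : Subgroup S} {χ : F.aut Q} :
    χ ∈ F.extendable Q ↔ F.Extends (χ : MulAut Q).toMonoidHom := Iff.rfl

/-- The projection of `Aut_F(Q)` to `Out_F(Q)`. -/
def toOut (Q : Subgroup S) : F.aut Q →* F.out Q :=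
  (QuotientGroup.mk' (Inn Q)).subgroupMap (F.aut Q)

theorem mem_ker_toOut {Q : Subgroup S} {χ : F.aut Q} :
    χ ∈ (F.toOut Q).ker ↔ ∃ q : Q, MulAut.conj q = (χ : MulAut Q) := by
  have : χ ∈ (F.toOut Q).ker ↔ (QuotientGroup.mk (χ : MulAut Q) : Out Q) = 1 := by
    rw [MonoidHom.mem_ker]
    exact Subtype.ext_iff
  rw [this, QuotientGroup.eq_one_iff]
  rfl

variable {F} in
theorem extends_of_receptive {p : ℕ} [Fact p.Prime] [Finite S] (hS : IsPGroup p S)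
    {Q : Subgroup S} (hQ : Q < ⊤) (hA : F.FullyAutomized p Q) (hR : F.Receptive Q)
    (hess : ¬ F.IsEssential p Q)
    (ih : ∀ R : Subgroup S, Q < R → ∀ φ ∈ F.Hom R ⊤, F.Extends φ) {χ : MulAut Q}
    (hχ : χ ∈ F.aut Q) : F.Extends χ.toMonoidHom := by
  by_cases hC : F.IsCentric Q
  · by_contra hcon
    refine hess ⟨hC, hA.fullyNormalized hS hR, (F.extendable Q).map (F.toOut Q), ?_⟩
    obtain ⟨T, hT⟩ := hA
    have hTm : ∀ {t}, t ∈ (T : Subgroup (F.aut Q)) ↔ (t : MulAut Q) ∈ autConj Q := by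
      intro t
      rw [hT, Subgroup.mem_subgroupOf]
    have hCQ : Subgroup.centralizer (Q : Set S) ≤ Q :=
      hC Q ⟨MulEquiv.refl _, isIso_of_mem (F.aut Q).one_mem⟩
    -- Conjugation by g agrees with an inner automorphism c_q only if q⁻¹g centralizes Q, and C_S(Q)
    -- ≤ Q by centricity.
    have hinner : ∀ {g : S} {t : F.aut Q}, (∀ x : Q, ((t : MulAut Q) x : S) = g * x * g⁻¹) →
        (t ∈ (F.toOut Q).ker ↔ g ∈ Q) := by
      intro g t h
      rw [mem_ker_toOut]
      constructor
      · rintro ⟨q, hq⟩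
        have : (q : S)⁻¹ * g ∈ Subgroup.centralizer (Q : Set S) := by
          rw [Subgroup.mem_centralizer_iff]
          intro x hx
          have := h ⟨x, hx⟩
          rw [← hq] at this
          change (q : S) * x * (q : S)⁻¹ = g * x * g⁻¹ at this
          have h2 : x = (q : S)⁻¹ * (g * x * g⁻¹) * q := by rw [← this]; group
          calc x * ((q : S)⁻¹ * g) = (q : S)⁻¹ * (g * x * g⁻¹) * q * ((q : S)⁻¹ * g) := by
                rw [← h2]
            _ = _ := by group
        simpa using Q.mul_mem q.2 (hCQ this)
      · intro hg
        exact ⟨⟨g, hg⟩, MulEquiv.ext fun x => Subtype.ext (h x).symm⟩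
    have : Finite (MulAut Q) := Finite.of_injective (fun α : MulAut Q => (α : Q → Q))
      DFunLike.coe_injective
    have hTK : (T : Subgroup (F.aut Q)) ≤ F.extendable Q := by
      intro t ht
      obtain ⟨g, -, h⟩ := mem_autConj.1 (hTm.1 ht)
      exact ⟨MulAut.conj g, F.conj_mem_autS g, h⟩
    have hker : (F.toOut Q).ker ≤ T := by
      intro t ht
      obtain ⟨q, hq⟩ := F.mem_ker_toOut.1 ht
      refine hTm.2 (mem_autConj.2 ⟨q, Subgroup.le_normalizer q.2, fun x => ?_⟩)
      rw [← hq]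
      rfl
    refine isStronglyEmbedded_map (F.toOut Q) (MonoidHom.subgroupMap_surjective _ _)
      (T.isPGroup'.to_le hker) T ?_ _ hTK (hker.trans hTK) ?_ ?_
    -- Normalizers grow in the p-group S, so N_S(Q) induces a non-inner automorphism of the proper
    -- subgroup Q.
    · intro hle
      have : Group.IsNilpotent S := hS.isNilpotent
      obtain ⟨g, hg, hgQ⟩ := SetLike.exists_of_lt
        (Group.normalizerCondition_of_isNilpotent Q hQ)
      have hmem : Q.normalizerMonoidHom ⟨g, hg⟩ ∈ F.aut Q :=
        F.conj_mem _ ⟨g, fun x => rfl⟩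
      have : (⟨_, hmem⟩ : F.aut Q) ∈ (T : Subgroup (F.aut Q)) := hTm.2 ⟨_, rfl⟩
      exact hgQ ((hinner fun x => rfl).1 (hle this))
    · intro htop
      exact hcon (mem_extendable.1 (htop.symm ▸ Subgroup.mem_top (⟨χ, hχ⟩ : F.aut Q)))
    -- If t = c_g with g outside Q and ztz⁻¹ is again in Aut_S(Q), then g lies in N_z and z extends.
    · intro z t ht htk hzt
      obtain ⟨g, hg, h⟩ := mem_autConj.1 (hTm.1 ht)
      rw [hinner h] at htk
      refine hR.extends_of_mem_extender ih z.2 (g := g) ?_ htk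
      obtain ⟨k, hk, h'⟩ := mem_autConj.1 (hTm.1 hzt)
      refine mem_extender.2 ⟨hg, k, hk, fun x y hy => ?_⟩
      have hxy : y = (t : MulAut Q) x := Subtype.ext (hy.trans (h x).symm)
      rw [← h', hxy]
      change _ = ((z : MulAut Q) ((t : MulAut Q) ((z : MulAut Q).symm ((z : MulAut Q) x))) : S)
      rw [MulEquiv.symm_apply_apply]
  -- Centricity may fail only at a conjugate R. The morphism ψ carries an element of C_S(R) outside
  -- R to one of C_S(Q) outside Q, and C_S(Q) lies in every extender.
  · obtain ⟨R, ⟨φ, hφ⟩, hRC⟩ : ∃ R, F.IsConj Q R ∧ ¬ Subgroup.centralizer (R : Set S) ≤ R := by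
      by_contra! h
      exact hC h
    obtain ⟨ψ, hψ, h, hs⟩ := exists_normalizer_hom hS hA hR ⟨φ.symm, hφ.symm⟩
    obtain ⟨c, hc, hcR⟩ := SetLike.not_le_iff_exists.1 hRC
    let c' : Subgroup.normalizer (R : Set S) := ⟨c, Subgroup.centralizer_le_normalizer _ hc⟩
    refine hR.extends_of_mem_extender ih hχ (g := ψ c') (centralizer_le_extender χ ?_)
      fun hm => hcR ((h c').1 hm)
    rw [Subgroup.mem_centralizer_iff]
    intro y hy
    obtain ⟨x, rfl⟩ := hs y hy
    have : x * c' = c' * x := Subtype.ext (Subgroup.mem_centralizer_iff.1 hc x ((h x).1 hy))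
    rw [← Subgroup.coe_mul, ← map_mul, this, map_mul, Subgroup.coe_mul]

/-! ### Alperin's fusion theorem without proper essential subgroups. -/

variable {F} in
/-- Alperin's fusion theorem when there are no proper essential subgroups: every morphism of `F`
is a restriction of an element of `Aut_F(S)`. -/
theorem extends_of_no_essential {p : ℕ} [Fact p.Prime] [Finite S] (hS : IsPGroup p S)
    (hF : F.IsSaturated p) (hess : ∀ P : Subgroup S, P < ⊤ → ¬ F.IsEssential p P)
    (P : Subgroup S) (φ : P →* (⊤ : Subgroup S)) (hφ : φ ∈ F.Hom P ⊤) : F.Extends φ := by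
  induction hn : Nat.card S - Nat.card P using Nat.strong_induction_on generalizing P with
  | _ n IH =>
  -- Induction is by order rather than inclusion, since it is applied to overgroups of conjugates of
  -- P.
  have ih : ∀ R : Subgroup S, Nat.card P < Nat.card R → ∀ φ ∈ F.Hom R ⊤, F.Extends φ :=
    fun R hR φ hφ => IH _ (by have := Subgroup.card_le_card_group R; omega) R φ hφ rfl
  rcases eq_or_ne P ⊤ with rfl | hP
  · let e : (⊤ : Subgroup S) ≃* (⊤ : Subgroup S) := MulEquiv.ofBijective φ
      (Finite.injective_iff_bijective.1 (F.injective φ hφ))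
    exact ⟨_, mem_autS_of_mem hφ (MulAut.congr Subgroup.topEquiv e) fun x => rfl, fun x => rfl⟩
  have : Group.IsNilpotent S := hS.isNilpotent
  obtain ⟨P', -, ψ, hψ, hψ', hφψ⟩ := F.exists_factor φ hφ
  obtain ⟨Q, hPQ, hA, hR⟩ := hF P
  -- Every conjugate of P is carried onto Q by an element of Aut_F(S), since N_S(R) is larger than R
  -- and its morphism to S extends by induction.
  have key : ∀ R, F.IsConj P R → ∃ (α : MulAut S) (_ : α ∈ F.autS) (e : R ≃* Q),
      F.IsIso e ∧ ∀ x, (e x : S) = α x := by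
    rintro R ⟨θ, hθ⟩
    have hcard : Nat.card P = Nat.card R := Nat.card_congr θ.toEquiv
    have hR' : R < ⊤ := lt_top_iff_ne_top.2 fun h => hP (by
      rw [← Subgroup.card_eq_iff_eq_top, hcard, h, Subgroup.card_top])
    obtain ⟨θ', hθ'⟩ := hPQ
    obtain ⟨η, hη, h, hs⟩ := exists_normalizer_hom hS hA hR ⟨_, hθ.symm.trans hθ'⟩
    obtain ⟨α, hα, hv⟩ := ih _ (hcard ▸ Set.Finite.card_lt_card (Set.toFinite _)
      (Group.normalizerCondition_of_isNilpotent R hR')) η hη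
    have hmap : R.map α.toMonoidHom = Q := by
      ext y
      constructor
      · rintro ⟨x, hx, rfl⟩
        have := (h ⟨x, Subgroup.le_normalizer hx⟩).2 hx
        rwa [hv] at this
      · intro hy
        obtain ⟨x, rfl⟩ := hs y hy
        exact ⟨x, (h x).1 hy, (hv x).symm⟩
    subst hmap
    exact ⟨α, hα, α.subgroupMap R, isIso_of_mem (mem_of_mem_autS hα _ fun _ => rfl),
      fun _ => rfl⟩
  obtain ⟨α, hα, e, he, hev⟩ := key P ⟨MulEquiv.refl _, isIso_of_mem (F.aut P).one_mem⟩
  obtain ⟨α', hα', e', he', hev'⟩ := key P' ⟨ψ, hψ, hψ'⟩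
  have hcard : Nat.card P = Nat.card Q := Nat.card_congr e.toEquiv
  have hQ : Q < ⊤ := lt_top_iff_ne_top.2 fun h => hP (by
    rw [← Subgroup.card_eq_iff_eq_top, hcard, h, Subgroup.card_top])
  -- Transporting ψ : P → P' to Q by α and α' gives an automorphism of Q in F. If β extends it, then
  -- α'⁻¹βα extends φ.
  have hχ : F.IsIso (e.symm.trans (ψ.trans e')) :=
    he.symm.trans (IsIso.trans ⟨hψ, hψ'⟩ he')
  obtain ⟨β, hβ, hβv⟩ := extends_of_receptive hS hQ hA hR (hess Q hQ)
    (fun R hR => ih R (hcard ▸ Set.Finite.card_lt_card (Set.toFinite _) hR)) hχ.1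
  refine ⟨α'⁻¹ * β * α, mul_mem (mul_mem (inv_mem hα') hβ) hα, fun x => ?_⟩
  have h1 := hβv (e x)
  rw [hev] at h1
  change _ = α'.symm (β (α x))
  rw [← h1, MulEquiv.eq_symm_apply, hφψ, ← hev']
  change _ = (e' (ψ (e.symm (e x))) : S)
  rw [e.symm_apply_apply]

/-! ### Comparison of the two unit groups. -/

/-- No condition on u⁻¹ is needed: marks are ring homomorphisms, so two marks that agree on u agree
on u⁻¹. -/
theorem mem_burnsideUnits_iff {u : (BurnsideRing S)ˣ} :
    u ∈ F.burnsideUnits ↔ ∀ P Q : Subgroup S, F.IsConj P Q →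
      BurnsideRing.mark P (u : BurnsideRing S) = BurnsideRing.mark Q (u : BurnsideRing S) := by
  constructor
  · rintro ⟨v, rfl⟩
    exact v.val.2
  · intro h
    have hinv : ((u⁻¹ : (BurnsideRing S)ˣ) : BurnsideRing S) ∈ F.burnsideRing := by
      intro P Q hPQ
      have h1 : Units.map (BurnsideRing.mark P : BurnsideRing S →* ℤ) u
          = Units.map (BurnsideRing.mark Q : BurnsideRing S →* ℤ) u := Units.ext (h P Q hPQ)
      have h2 := congrArg (·⁻¹) h1
      simp only [← map_inv] at h2
      exact congrArg Units.val h2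
    exact ⟨⟨⟨u, h⟩, ⟨_, hinv⟩, Subtype.ext u.mul_inv, Subtype.ext u.inv_mul⟩, Units.ext rfl⟩

theorem mem_fixedPoints_outS_iff {u : (BurnsideRing S)ˣ} :
    u ∈ FixedPoints.subgroup F.outS (BurnsideRing S)ˣ ↔
      ∀ α ∈ F.autS, α • (u : BurnsideRing S) = u := by
  constructor
  · intro h α hα
    exact congrArg Units.val (h ⟨QuotientGroup.mk α, α, hα, rfl⟩)
  · rintro h ⟨_, α, hα, rfl⟩
    exact Units.ext (h α hα)

end FusionSystem

theorem corollary6p2 {p : ℕ} (hp : p.Prime) {S : Type u} [Group S] [Finite S]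
    (hS : IsPGroup p S) (F : FusionSystem S) (hF : F.IsSaturated p)
    (hess : ∀ P : Subgroup S, P < ⊤ → ¬ F.IsEssential p P) :
    F.burnsideUnits = FixedPoints.subgroup F.outS (BurnsideRing S)ˣ := by
  have : Fact p.Prime := ⟨hp⟩
  ext u
  rw [F.mem_burnsideUnits_iff, F.mem_fixedPoints_outS_iff]
  constructor
  · intro h α hα
    refine BurnsideRing.ext_mark _ _ fun P => ?_
    rw [BurnsideRing.mark_smul]
    exact (h _ _ (F.isConj_map (inv_mem hα) P)).symm
  · rintro h P Q ⟨φ, hφ⟩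
    obtain ⟨α, hα, hv⟩ := FusionSystem.extends_of_no_essential hS hF hess P _
      (F.comp_mem _ (Subgroup.inclusion le_top) hφ.1 (F.conj_mem _ ⟨1, fun x => by simp⟩))
    have hv' : ∀ x, (φ x : S) = α x := hv
    have hmap : P.map α.toMonoidHom = Q := by
      ext y
      constructor
      · rintro ⟨x, hx, rfl⟩
        exact (hv' ⟨x, hx⟩).subst (motive := (· ∈ Q)) (φ _).2
      · intro hy
        obtain ⟨x, hx⟩ := φ.surjective ⟨y, hy⟩
        exact ⟨x, x.2, (hv' x).symm.trans (congrArg Subtype.val hx)⟩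
    -- The inverse is used because the mark of α⁻¹·u at P is the mark of u at α(P) = Q.
    have := BurnsideRing.mark_smul α⁻¹ P (u : BurnsideRing S)
    rw [h _ (inv_mem hα), inv_inv, hmap] at this
    exact this
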